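/- Let $\mathbb{M}_{n_1,n_2}$ be the space of $n_1\times n_2$ matrices over $\mathbb{R}$ or $\mathbb{C}$ ($n_1,n_2\ge 1$) with the Frobenius norm and the real scalar product $\operatorname{Re}\operatorname{tr}(X^*Y)$. Let $\mathcal{A}:\mathbb{M}_{n_1,n_2}\to H$ be a (real-)linear operator into a finite-dimensional real inner product space $H$ (for example $H=\mathbb{R}^m$, or $H=\mathbb{C}^m$ with the real part of its inner product), let $b\in H$, $\mu\ge 0$ and let $K\ge 1$ be an integer. Define $\delta_{2K}^-$ by $$1-\delta_{2K}^-=\inf\left\{\frac{\|\mathcal{A}X\|^2}{\|X\|^2}:\ X\ne 0,\ \operatorname{rank}(X)\le 2K\right\}$$ and assume $\delta_{2K}^-<1$. For a nonnegative functional $f$ on $\mathbb{M}_{n_1,n_2}$ put $\mathcal{S}_2(f)(Y)=\sup_X\big(-f(X)-\|X-Y\|^2\big)$ and let $\mathcal{Q}_2(f)=\mathcal{S}_2(\mathcal{S}_2(f))$ be its quadratic envelope. Set $$\mathcal{R}_\mu(X)=\mu\operatorname{rank}(X)+\|\mathcal{A}X-b\|^2,\qquad \mathcal{R}_{\mu,reg}(X)=\mathcal{Q}_2(\mu\operatorname{rank})(X)+\|\mathcal{A}X-b\|^2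 .$$ A point $X$ is called stationary for a functional $g$ if $\liminf_{Y\to X,\,Y\ne X}\frac{g(Y)-g(X)}{\|Y-X\|}\ge 0$. Let $X'$ be a stationary point of $\mathcal{R}_{\mu,reg}$ with $\operatorname{rank}(X')\le K$, let $Z'=(I-\mathcal{A}^*\mathcal{A})X'+\mathcal{A}^*b$, and assume that the singular values of $Z'$ satisfy $$\sigma_i(Z')\notin\left[(1-\delta_{2K}^-)\sqrt{\mu},\ \frac{1}{1-\delta_{2K}^-}\sqrt{\mu}\right]\qquad (1\le i\le \min(n_1,n_2)).$$ Then $X'$ is the unique solution of $\operatorname{argmin}_{\operatorname{rank}(X)\le K}\mathcal{R}_{\mu,reg}(X)$, and every stationary point $X''\ne X'$ of $\mathcal{R}_{\mu,reg}$ satisfies $\operatorname{rank}(X'')>K$. If, in addition, the operator norm satisfies $\|\mathcal{A}\|<1$ and $\|\mathcal{A}X'-b\|^2\le\mu$, then $X'$ is a global minimizer of both $\mathcal{R}_\mu$ and $\mathcal{R}_{\mu,reg}$. -/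

import Mathlib

open Filter Topology
open scoped Matrix.Norms.Frobenius

noncomputable section

namespace RankReg

/-- The real Frobenius scalar product `Re tr(Xᴴ Y)` on real or complex matrices; its norm is
Mathlib's Frobenius norm. -/
instance frobeniusInner {𝕜 : Type*} [RCLike 𝕜] {n₁ n₂ : ℕ} :
    InnerProductSpace ℝ (Matrix (Fin n₁) (Fin n₂) 𝕜) where
  inner X Y := RCLike.re (Matrix.trace (Matrix.conjTranspose X * Y))
  norm_sq_eq_re_inner X := by
    have h0 : 0 ≤ ∑ i, ∑ j, ‖X i j‖ ^ 2 :=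
      Finset.sum_nonneg fun i _ => Finset.sum_nonneg fun j _ => by positivity
    rw [Matrix.frobenius_norm_def, ← Real.sqrt_eq_rpow]
    simp only [Real.rpow_two]
    rw [Real.sq_sqrt h0, Finset.sum_comm]
    simp only [Matrix.trace, Matrix.diag_apply, Matrix.mul_apply, Matrix.conjTranspose_apply,
      map_sum]
    refine Finset.sum_congr rfl fun j _ => Finset.sum_congr rfl fun i _ => ?_
    rw [RCLike.star_def, RCLike.conj_mul]
    norm_cast
  conj_inner_symm X Y := by
    have h : Matrix.trace (Matrix.conjTranspose X * Y)
        = star (Matrix.trace (Matrix.conjTranspose Y * X)) := by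
      rw [← Matrix.trace_conjTranspose]; simp
    simp [h]
  add_left X Y Z := by simp [Matrix.add_mul]
  smul_left X Y r := by
    simp [Matrix.conjTranspose_smul, Matrix.smul_mul, Matrix.trace_smul, RCLike.smul_re]

/-- The transform `S_γ(f)(y) = sup_x (-f(x) - (γ/2) ‖x - y‖²)`. -/
def sTransform {V : Type*} [NormedAddCommGroup V] (γ : ℝ) (f : V → ℝ) (y : V) : ℝ :=
  ⨆ x, (-f x - γ / 2 * ‖x - y‖ ^ 2)

/-- The quadratic envelope `Q_γ = S_γ ∘ S_γ`. For real-valued `f ≥ 0` and `γ ≥ 0` both suprema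
are over nonempty sets that are bounded above. -/
def quadEnvelope {V : Type*} [NormedAddCommGroup V] (γ : ℝ) (f : V → ℝ) : V → ℝ :=
  sTransform γ (sTransform γ f)

/-- `x` is a stationary point of `g` if
`liminf_{y → x, y ≠ x} (g(y) - g(x)) / ‖y - x‖ ≥ 0` (limit inferior in the extended reals). -/
def IsStationary {V : Type*} [NormedAddCommGroup V] (g : V → ℝ) (x : V) : Prop :=
  0 ≤ liminf (fun y => (((g y - g x) / ‖y - x‖ : ℝ) : EReal)) (𝓝[≠] x)

section Operators

variable {V H : Type*} [NormedAddCommGroup V] [InnerProductSpace ℝ V] [FiniteDimensional ℝ V]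
  [NormedAddCommGroup H] [InnerProductSpace ℝ H] [FiniteDimensional ℝ H]

/-- The operator norm of a linear operator between finite-dimensional spaces. -/
def opNorm (A : V →ₗ[ℝ] H) : ℝ :=
  ‖LinearMap.toContinuousLinearMap A‖

/-- The point `Z = (I - A*A) X + A* b`. For complex matrices the adjoint is taken with respect to
the real scalar products `Re ⟨·,·⟩`; if `A` is complex linear it is the complex adjoint. -/
def zPoint (A : V →ₗ[ℝ] H) (b : H) (X : V) : V :=
  X - LinearMap.adjoint A (A X) + LinearMap.adjoint A b

end Operators

section Matrices

variable {𝕜 : Type*} [RCLike 𝕜] {n₁ n₂ : ℕ}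
  {H : Type*} [NormedAddCommGroup H] [InnerProductSpace ℝ H]

/-- The singular values of a matrix in non-increasing order with multiplicity, indexed by
`0, …, min n₁ n₂ - 1`. -/
def sigma (Z : Matrix (Fin n₁) (Fin n₂) 𝕜) (i : Fin (min n₁ n₂)) : ℝ :=
  (Matrix.toEuclideanLin Z).singularValues i

/-- The lower restricted isometry constant `δ_K⁻` of `A`, defined by
`1 - δ_K⁻ = inf {‖A X‖² / ‖X‖² : X ≠ 0, rank X ≤ K}`. The set is bounded below by `0`, and it is
nonempty as soon as `K`, `n₁`, `n₂` are positive. -/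
def lrip (A : Matrix (Fin n₁) (Fin n₂) 𝕜 →ₗ[ℝ] H) (K : ℕ) : ℝ :=
  1 - sInf {r : ℝ | ∃ X : Matrix (Fin n₁) (Fin n₂) 𝕜,
    X ≠ 0 ∧ X.rank ≤ K ∧ r = ‖A X‖ ^ 2 / ‖X‖ ^ 2}

/-- The functional `μ rank(X) + ‖A X - b‖²`. -/
def rankFunctional (μ : ℝ) (A : Matrix (Fin n₁) (Fin n₂) 𝕜 →ₗ[ℝ] H) (b : H)
    (X : Matrix (Fin n₁) (Fin n₂) 𝕜) : ℝ :=
  μ * (X.rank : ℝ) + ‖A X - b‖ ^ 2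

/-- The functional `Q₂(μ rank)(X) + ‖A X - b‖²`. -/
def regFunctional (μ : ℝ) (A : Matrix (Fin n₁) (Fin n₂) 𝕜 →ₗ[ℝ] H) (b : H)
    (X : Matrix (Fin n₁) (Fin n₂) 𝕜) : ℝ :=
  quadEnvelope 2 (fun Y : Matrix (Fin n₁) (Fin n₂) 𝕜 => μ * (Y.rank : ℝ)) X + ‖A X - b‖ ^ 2

end Matrices

end RankReg

end

/-! Write the regularized functional as `G + q`, where `G` is the convex envelope of `μ rank + ‖·‖²`
and `q X = ‖A X - b‖² - ‖X‖²`. Stationarity says exactly what convexity wants: the matrix `Z =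
zPoint A b X`, for which `-2 Z` is the gradient of `q`, is half a subgradient of `G`
(`isSubgrad_zPoint`). Let `δ` be the lower isometry constant. Along differences of rank at most
`2K`, `q` loses at most `δ ‖D‖²`. The spectral gap of `Z'` makes `G` gain `κ ‖D‖²` with `κ > δ`,
both as growth above its supporting plane and as strong monotonicity (`exists_strong_bounds`).
Adding the two gives strict minimality and excludes a second stationary point of rank at most `K`.

The gain is a statement about real numbers (`Thresholded.monotone`, `Thresholded.bregman`).
Hermitian dilations carry it to matrices: inner products of two dilations average products of
eigenvalues against a doubly stochastic matrix, so no ordering of singular values is needed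
(`spectral_sum_nonneg`).

For the global claim, the gap also makes `G` touch `μ rank + ‖·‖²` at `X'`, the residual bound
handles ranks above `K`, and for a contraction `A` the function `q` is concave, so passing to the
envelope does not lower the infimum. -/

namespace RankReg

/-! ### Convex conjugates, envelopes and subgradients. -/

section Envelope

variable {V : Type*} [NormedAddCommGroup V] [InnerProductSpace ℝ V]

/-- The convex conjugate of `f + ‖·‖²` for the pairing `2⟪·,·⟫`. -/
noncomputable def conjFun (f : V → ℝ) (Y : V) : ℝ := sTransform 2 f Y + ‖Y‖ ^ 2

/-- The convex envelope of `f + ‖·‖²`. -/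
noncomputable def convEnv (f : V → ℝ) (X : V) : ℝ := quadEnvelope 2 f X + ‖X‖ ^ 2

variable {f : V → ℝ}

/-- Expanding `‖W - Y‖²` leaves a supremum of functions affine in `Y`. Nonnegativity of `f` bounds
the family, so the real `⨆` is a true supremum. -/
lemma le_conjFun (hf : ∀ x, 0 ≤ f x) (W Y : V) :
    2 * inner ℝ W Y - ‖W‖ ^ 2 - f W ≤ conjFun f Y := by
  have hb : BddAbove (Set.range fun x => -f x - 2 / 2 * ‖x - Y‖ ^ 2) := by
    refine ⟨0, ?_⟩
    rintro _ ⟨x, rfl⟩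
    have := hf x
    have := sq_nonneg ‖x - Y‖
    dsimp only
    linarith
  have h := le_ciSup hb W
  have h' := norm_sub_sq_real W Y
  unfold conjFun sTransform
  linarith

lemma conjFun_le {Y : V} {B : ℝ} (h : ∀ W, 2 * inner ℝ W Y - ‖W‖ ^ 2 - f W ≤ B) :
    conjFun f Y ≤ B := by
  have : sTransform 2 f Y ≤ B - ‖Y‖ ^ 2 := by
    refine ciSup_le fun W => ?_
    have h' := norm_sub_sq_real W Y
    linarith [h W]
  unfold conjFun
  linarith

lemma le_convEnv (hf : ∀ x, 0 ≤ f x) (X Y : V) :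
    2 * inner ℝ X Y - conjFun f Y ≤ convEnv f X := by
  have hb : BddAbove (Set.range fun y => -sTransform 2 f y - 2 / 2 * ‖y - X‖ ^ 2) := by
    refine ⟨f X, ?_⟩
    rintro _ ⟨y, rfl⟩
    have h1 := le_conjFun hf X y
    have h2 := norm_sub_sq_real X y
    rw [norm_sub_rev] at h2
    unfold conjFun at h1
    dsimp only
    linarith
  have h := le_ciSup hb Y
  have h' := norm_sub_sq_real X Y
  rw [norm_sub_rev] at h'
  have e : quadEnvelope 2 f X = ⨆ y, -sTransform 2 f y - 2 / 2 * ‖y - X‖ ^ 2 := rfl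
  unfold convEnv conjFun
  rw [e]
  linarith

lemma convEnv_le {X : V} {B : ℝ} (h : ∀ Y, 2 * inner ℝ X Y - conjFun f Y ≤ B) :
    convEnv f X ≤ B := by
  have : quadEnvelope 2 f X ≤ B - ‖X‖ ^ 2 := by
    refine ciSup_le fun Y => ?_
    have h' := norm_sub_sq_real X Y
    rw [norm_sub_rev] at h'
    have := h Y
    unfold conjFun at this
    linarith
  unfold convEnv
  linarith

lemma convEnv_le_self (hf : ∀ x, 0 ≤ f x) (X : V) : convEnv f X ≤ ‖X‖ ^ 2 + f X :=
  convEnv_le fun Y => by linarith [le_conjFun hf X Y]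

lemma convEnv_segment_le (hf : ∀ x, 0 ≤ f x) (X W : V) {t : ℝ} (h0 : 0 ≤ t) (h1 : t ≤ 1) :
    convEnv f (X + t • (W - X)) ≤ convEnv f X + t * (convEnv f W - convEnv f X) := by
  refine convEnv_le fun Y => ?_
  have hX := le_convEnv hf X Y
  have hW := le_convEnv hf W Y
  rw [inner_add_left, real_inner_smul_left, inner_sub_left]
  nlinarith [mul_le_mul_of_nonneg_left hW h0, mul_le_mul_of_nonneg_left hX (sub_nonneg.2 h1)]

/-- `Z` is half a subgradient of `convEnv f` at `X`. -/
def IsSubgrad (f : V → ℝ) (X Z : V) : Prop :=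
  ∀ W, convEnv f X + 2 * inner ℝ Z (W - X) ≤ convEnv f W

lemma IsSubgrad.fenchel (hf : ∀ x, 0 ≤ f x) {X Z : V} (h : IsSubgrad f X Z) :
    convEnv f X + conjFun f Z ≤ 2 * inner ℝ X Z := by
  have : conjFun f Z ≤ 2 * inner ℝ X Z - convEnv f X := by
    refine conjFun_le fun W => ?_
    have h1 := h W
    have h2 := convEnv_le_self hf W
    rw [inner_sub_right, real_inner_comm W, real_inner_comm X] at h1
    linarith
  linarith

lemma IsSubgrad.monotone {X Z X₁ Z₁ : V} (h : IsSubgrad f X Z) (h₁ : IsSubgrad f X₁ Z₁) :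
    0 ≤ (inner ℝ (Z - Z₁) (X - X₁) : ℝ) := by
  have a := h X₁
  have b := h₁ X
  rw [inner_sub_right] at a b
  rw [inner_sub_left, inner_sub_right, inner_sub_right]
  linarith

lemma isSubgrad_of_fenchel (hf : ∀ x, 0 ≤ f x) {X Z : V}
    (h : convEnv f X + conjFun f Z ≤ 2 * inner ℝ X Z) : IsSubgrad f X Z := by
  intro W
  have := le_convEnv hf W Z
  rw [inner_sub_right, real_inner_comm W Z, real_inner_comm X Z]
  linarith

/-- Uniqueness of the Minty decomposition of a point into a pair of the subdifferential. -/
lemma IsSubgrad.eq_of_add_eq {X Z X₁ Z₁ : V} (h : IsSubgrad f X Z) (h₁ : IsSubgrad f X₁ Z₁)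
    (hs : X + Z = X₁ + Z₁) : X = X₁ ∧ Z = Z₁ := by
  have hm := h.monotone h₁
  have e : X - X₁ = -(Z - Z₁) := by
    rw [neg_sub, sub_eq_sub_iff_add_eq_add, hs, add_comm]
  rw [e, inner_neg_right, real_inner_self_eq_norm_sq] at hm
  have hz : Z - Z₁ = 0 := by
    rw [← norm_eq_zero]
    nlinarith [norm_nonneg (Z - Z₁)]
  exact ⟨by rw [← sub_eq_zero, e, hz, neg_zero], sub_eq_zero.1 hz⟩

end Envelope

/-! ### The quadratic part and stationarity. -/

section Quadratic

lemma norm_le_opNorm_mul {V H : Type*} [NormedAddCommGroup V] [InnerProductSpace ℝ V]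
    [FiniteDimensional ℝ V] [NormedAddCommGroup H] [InnerProductSpace ℝ H]
    (A : V →ₗ[ℝ] H) (D : V) : ‖A D‖ ≤ opNorm A * ‖D‖ :=
  (LinearMap.toContinuousLinearMap A).le_opNorm D

variable {V H : Type*} [NormedAddCommGroup V] [InnerProductSpace ℝ V] [FiniteDimensional ℝ V]
  [NormedAddCommGroup H] [InnerProductSpace ℝ H] [FiniteDimensional ℝ H] {f : V → ℝ}

/-- Exact second-order Taylor expansion at `X` of `‖A · - b‖² - ‖·‖²`, whose gradient is `-2
zPoint`. -/
lemma residual_expand (A : V →ₗ[ℝ] H) (b : H) (X W : V) :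
    ‖A W - b‖ ^ 2 - ‖W‖ ^ 2 = ‖A X - b‖ ^ 2 - ‖X‖ ^ 2 + ‖A (W - X)‖ ^ 2 - ‖W - X‖ ^ 2
      - 2 * inner ℝ (zPoint A b X) (W - X) := by
  obtain ⟨D, rfl⟩ : ∃ D, W = X + D := ⟨W - X, by simp⟩
  have e : A (X + D) - b = (A X - b) + A D := by rw [map_add]; abel
  have hz : inner ℝ (zPoint A b X) D = inner ℝ X D - inner ℝ (A X - b) (A D) := by
    unfold zPoint
    rw [inner_add_left, inner_sub_left, LinearMap.adjoint_inner_left, LinearMap.adjoint_inner_left,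
      inner_sub_left]
    ring
  rw [e, norm_add_sq_real, norm_add_sq_real, add_sub_cancel_left, hz]
  ring

/-- If the subgradient inequality failed at `W` by `ε`, convexity would make the functional drop by
`t ε - O(t²)` on the segment from `X` to `W`, while stationarity allows a drop of less than `t ε /
2` for small `t`. -/
lemma isSubgrad_zPoint (hf : ∀ x, 0 ≤ f x) (A : V →ₗ[ℝ] H) (b : H) {X : V}
    (hX : IsStationary (fun X => quadEnvelope 2 f X + ‖A X - b‖ ^ 2) X) :
    IsSubgrad f X (zPoint A b X) := by
  intro W
  by_cases hD : W - X = 0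
  · rw [sub_eq_zero] at hD
    simp [hD]
  have hn : 0 < ‖W - X‖ := norm_pos_iff.2 hD
  set D := W - X with hDdef
  by_contra! hlt
  set ε := convEnv f X + 2 * inner ℝ (zPoint A b X) D - convEnv f W with hε
  have hε0 : 0 < ε := by linarith
  set G : V → ℝ := fun X => quadEnvelope 2 f X + ‖A X - b‖ ^ 2 with hG
  have hev : ∀ᶠ y in 𝓝[≠] X, -(ε / (2 * ‖D‖)) < (G y - G X) / ‖y - X‖ := by
    have : ((-(ε / (2 * ‖D‖)) : ℝ) : EReal) <
        liminf (fun y => (((G y - G X) / ‖y - X‖ : ℝ) : EReal)) (𝓝[≠] X) := by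
      refine lt_of_lt_of_le ?_ hX
      rw [← EReal.coe_zero, EReal.coe_lt_coe_iff, neg_lt_zero]
      positivity
    filter_upwards [eventually_lt_of_lt_liminf this] with y hy
    exact_mod_cast hy
  have htend : Tendsto (fun t : ℝ => X + t • D) (𝓝[>] 0) (𝓝[≠] X) := by
    refine tendsto_nhdsWithin_iff.2 ⟨?_, ?_⟩
    · have : Tendsto (fun t : ℝ => X + t • D) (𝓝 0) (𝓝 (X + (0 : ℝ) • D)) := by
        apply Continuous.tendsto
        fun_prop
      rw [zero_smul, add_zero] at this
      exact this.mono_left nhdsWithin_le_nhds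
    · filter_upwards [self_mem_nhdsWithin] with t ht
      have : t • D ≠ 0 := smul_ne_zero (ne_of_gt ht) hD
      simpa using this
  have hsmall : ∀ᶠ t in 𝓝[>] (0 : ℝ), t * ‖A D‖ ^ 2 < ε / 2 := by
    have : Tendsto (fun t : ℝ => t * ‖A D‖ ^ 2) (𝓝 0) (𝓝 (0 * ‖A D‖ ^ 2)) := by
      apply Continuous.tendsto
      fun_prop
    rw [zero_mul] at this
    exact (this.mono_left nhdsWithin_le_nhds).eventually_lt_const (by linarith)
  have hone : ∀ᶠ t in 𝓝[>] (0 : ℝ), t < 1 :=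
    nhdsWithin_le_nhds (gt_mem_nhds one_pos)
  obtain ⟨t, h1, h2, h3, ht⟩ :=
    ((htend.eventually hev).and (hsmall.and (hone.and self_mem_nhdsWithin))).exists
  have ht : 0 < t := ht
  have hconv := convEnv_segment_le hf X W ht.le h3.le
  rw [← hDdef] at hconv
  have hexp := residual_expand A b X (X + t • D)
  rw [add_sub_cancel_left, map_smul, norm_smul, norm_smul, inner_smul_right, Real.norm_eq_abs,
    abs_of_pos ht] at hexp
  rw [add_sub_cancel_left, norm_smul, Real.norm_eq_abs, abs_of_pos ht,
    lt_div_iff₀ (by positivity)] at h1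
  have e : -(ε / (2 * ‖D‖)) * (t * ‖D‖) = -(t * (ε / 2)) := by
    field_simp
  rw [e] at h1
  have hd : G (X + t • D) - G X ≤ t * (-ε) + t * (t * ‖A D‖ ^ 2) := by
    unfold convEnv at hconv hε
    simp only [hG, hε]
    nlinarith [sq_nonneg (t * ‖D‖)]
  nlinarith [mul_lt_mul_of_pos_left h2 ht]

/-- If `m` is a lower bound of `f + ‖A · - b‖²` and `A` is a contraction, it is also a lower bound
of the functional with `f` replaced by its quadratic envelope. -/
lemma le_quadEnvelope_add_of_contraction (hf : ∀ x, 0 ≤ f x) (A : V →ₗ[ℝ] H) (b : H)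
    (hA : ∀ D, ‖A D‖ ≤ ‖D‖) {m : ℝ} (hm : ∀ W, m ≤ f W + ‖A W - b‖ ^ 2) (X : V) :
    m ≤ quadEnvelope 2 f X + ‖A X - b‖ ^ 2 := by
  -- For a contraction, `‖A · - b‖² - ‖·‖²` lies below its tangent at `X`; subtracting that tangent
  -- from `m` gives an affine minorant of `f + ‖·‖²`.
  have h1 : conjFun f (zPoint A b X) ≤
      2 * inner ℝ X (zPoint A b X) - (m - ‖A X - b‖ ^ 2 + ‖X‖ ^ 2) := by
    refine conjFun_le fun W => ?_
    have e := residual_expand A b X W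
    have h2 := hm W
    have h3 : ‖A (W - X)‖ ^ 2 ≤ ‖W - X‖ ^ 2 := by
      gcongr
      exact hA _
    rw [inner_sub_right] at e
    rw [real_inner_comm _ X, real_inner_comm _ W]
    linarith
  have h2 := le_convEnv hf X (zPoint A b X)
  unfold convEnv at h2
  linarith

end Quadratic

/-! ### Spectral calculus for rectangular matrices through Hermitian dilations. -/

section Dilation

open Matrix

variable {𝕜 : Type*} [RCLike 𝕜] {n₁ n₂ : ℕ}

/-- The Hermitian dilation of a rectangular matrix. -/
def dilation (X : Matrix (Fin n₁) (Fin n₂) 𝕜) :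
    Matrix (Fin n₁ ⊕ Fin n₂) (Fin n₁ ⊕ Fin n₂) 𝕜 :=
  fromBlocks 0 X Xᴴ 0

/-- The columns of the unitary matrix `U` are eigenvectors of the dilation of `X`, with
eigenvalues `x`. -/
def Diagonalizes (U : Matrix (Fin n₁ ⊕ Fin n₂) (Fin n₁ ⊕ Fin n₂) 𝕜) (x : Fin n₁ ⊕ Fin n₂ → ℝ)
    (X : Matrix (Fin n₁) (Fin n₂) 𝕜) : Prop :=
  Uᴴ * U = 1 ∧ dilation X = U * diagonal (fun i => (x i : 𝕜)) * Uᴴ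

lemma dilation_isHermitian (X : Matrix (Fin n₁) (Fin n₂) 𝕜) : (dilation X).IsHermitian := by
  simp [dilation, Matrix.IsHermitian, fromBlocks_conjTranspose]

lemma exists_diagonalizes (X : Matrix (Fin n₁) (Fin n₂) 𝕜) : ∃ U x, Diagonalizes U x X := by
  have h := dilation_isHermitian X
  refine ⟨h.eigenvectorUnitary, h.eigenvalues, ?_, ?_⟩
  · exact mem_unitaryGroup_iff'.1 h.eigenvectorUnitary.2
  · conv_lhs => rw [h.spectral_theorem]
    simp [Unitary.conjStarAlgAut_apply, star_eq_conjTranspose, Function.comp_def]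

variable {U V : Matrix (Fin n₁ ⊕ Fin n₂) (Fin n₁ ⊕ Fin n₂) 𝕜} {x y : Fin n₁ ⊕ Fin n₂ → ℝ}
  {X Y : Matrix (Fin n₁) (Fin n₂) 𝕜}

lemma Diagonalizes.combine (hX : Diagonalizes U x X) (hY : Diagonalizes U y Y) (α β : ℝ) :
    Diagonalizes U (fun i => α * x i + β * y i) (α • X + β • Y) := by
  refine ⟨hX.1, ?_⟩
  have e1 : dilation (α • X + β • Y) = α • dilation X + β • dilation Y := by
    simp [dilation, fromBlocks_smul, fromBlocks_add, conjTranspose_smul]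
  have e2 : diagonal (fun i => ((α * x i + β * y i : ℝ) : 𝕜)) =
      α • diagonal (fun i => (x i : 𝕜)) + β • diagonal (fun i => (y i : 𝕜)) := by
    ext i j
    by_cases hij : i = j
    · subst hij
      simp [RCLike.real_smul_eq_coe_mul]
    · simp [hij]
  rw [e1, hX.2, hY.2, e2]
  simp [Matrix.mul_add, Matrix.add_mul]

lemma two_inner_eq_trace (X Y : Matrix (Fin n₁) (Fin n₂) 𝕜) :
    2 * inner ℝ X Y = RCLike.re (trace (dilation X * dilation Y)) := by
  have h : trace (X * Yᴴ) = star (trace (Xᴴ * Y)) := by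
    rw [← trace_conjTranspose, conjTranspose_mul, conjTranspose_conjTranspose, trace_mul_comm]
  have h2 : inner ℝ X Y = RCLike.re (trace (Xᴴ * Y)) := rfl
  rw [h2, dilation, dilation, fromBlocks_multiply]
  have h3 (P : Matrix (Fin n₁) (Fin n₁) 𝕜) (Q R) (S : Matrix (Fin n₂) (Fin n₂) 𝕜) :
      trace (fromBlocks P Q R S) = trace P + trace S := by
    simp [trace]
  rw [h3]
  simp [h]
  ring

/-- The squared moduli of the entries of `Uᴴ V`; a doubly stochastic matrix if `U` and `V` are
unitary. -/
noncomputable def overlap (U V : Matrix (Fin n₁ ⊕ Fin n₂) (Fin n₁ ⊕ Fin n₂) 𝕜)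
    (i j : Fin n₁ ⊕ Fin n₂) : ℝ :=
  ‖(Uᴴ * V) i j‖ ^ 2

lemma overlap_row_sum (hU : Uᴴ * U = 1) (hV : Vᴴ * V = 1) (i : Fin n₁ ⊕ Fin n₂) :
    ∑ j, overlap U V i j = 1 := by
  have h : (Uᴴ * V) * (Uᴴ * V)ᴴ = 1 := by
    rw [conjTranspose_mul, conjTranspose_conjTranspose, Matrix.mul_assoc, ← Matrix.mul_assoc V,
      mul_eq_one_comm.1 hV, Matrix.one_mul, hU]
  have h' := congrFun (congrFun h i) i
  rw [mul_apply, one_apply_eq] at h'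
  simp only [conjTranspose_apply, RCLike.star_def, RCLike.mul_conj] at h'
  unfold overlap
  exact_mod_cast h'

lemma overlap_col_sum (hU : Uᴴ * U = 1) (hV : Vᴴ * V = 1) (j : Fin n₁ ⊕ Fin n₂) :
    ∑ i, overlap U V i j = 1 := by
  rw [← overlap_row_sum hV hU j]
  refine Finset.sum_congr rfl fun i _ => ?_
  unfold overlap
  rw [show Vᴴ * U = (Uᴴ * V)ᴴ by simp, conjTranspose_apply, norm_star]

lemma two_inner_eq_sum (hX : Diagonalizes U x X) (hY : Diagonalizes V y Y) :
    2 * inner ℝ X Y = ∑ i, ∑ j, overlap U V i j * (x i * y j) := by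
  rw [two_inner_eq_trace, hX.2, hY.2]
  have e : trace (U * diagonal (fun i => (x i : 𝕜)) * Uᴴ * (V * diagonal (fun i => (y i : 𝕜)) * Vᴴ))
      = trace ((diagonal (fun i => (x i : 𝕜)) * (Uᴴ * V)) *
        (diagonal (fun i => (y i : 𝕜)) * (Uᴴ * V)ᴴ)) := by
    rw [Matrix.mul_assoc U, Matrix.mul_assoc U, trace_mul_comm U]
    simp [Matrix.mul_assoc]
  rw [e, trace, map_sum]
  refine Finset.sum_congr rfl fun i _ => ?_
  rw [diag_apply, mul_apply, map_sum]
  refine Finset.sum_congr rfl fun j _ => ?_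
  rw [diagonal_mul, diagonal_mul, conjTranspose_apply, overlap, RCLike.star_def]
  have : (x i : 𝕜) * (Uᴴ * V) i j * ((y j : 𝕜) * (starRingEnd 𝕜) ((Uᴴ * V) i j)) =
      ((‖(Uᴴ * V) i j‖ ^ 2 * (x i * y j) : ℝ) : 𝕜) := by
    push_cast
    rw [← RCLike.mul_conj]
    ring
  rw [this, RCLike.ofReal_re]

lemma two_inner_eq_sum_of_same (hX : Diagonalizes U x X) (hY : Diagonalizes U y Y) :
    2 * inner ℝ X Y = ∑ i, x i * y i := by
  rw [two_inner_eq_sum hX hY]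
  refine Finset.sum_congr rfl fun i _ => ?_
  rw [Finset.sum_eq_single i]
  · simp [overlap, hX.1]
  · intro j _ hj
    simp [overlap, hX.1, one_apply_ne hj.symm]
  · simp

lemma two_norm_sq_eq_sum (hX : Diagonalizes U x X) : 2 * ‖X‖ ^ 2 = ∑ i, x i ^ 2 := by
  rw [← real_inner_self_eq_norm_sq, two_inner_eq_sum_of_same hX hX]
  simp [sq]

/-- A termwise inequality between spectra carries over to matrices, by averaging against the
doubly stochastic matrix `overlap U V`. -/
lemma spectral_sum_nonneg {x' y' : Fin n₁ ⊕ Fin n₂ → ℝ} {X' Y' : Matrix (Fin n₁) (Fin n₂) 𝕜}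
    (hX : Diagonalizes U x X) (hX' : Diagonalizes U x' X') (hY : Diagonalizes V y Y)
    (hY' : Diagonalizes V y' Y') (a b : Fin n₁ ⊕ Fin n₂ → ℝ)
    (h : ∀ i j, 0 ≤ a i + b j + x i * y j + x' i * y' j) :
    0 ≤ ∑ i, a i + ∑ j, b j + 2 * inner ℝ X Y + 2 * inner ℝ X' Y' := by
  have ha : ∑ i, a i = ∑ i, ∑ j, overlap U V i j * a i :=
    Finset.sum_congr rfl fun i _ => by rw [← Finset.sum_mul, overlap_row_sum hX.1 hY.1, one_mul]
  have hb : ∑ j, b j = ∑ i, ∑ j, overlap U V i j * b j := by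
    rw [Finset.sum_comm]
    exact Finset.sum_congr rfl fun j _ => by
      rw [← Finset.sum_mul, overlap_col_sum hX.1 hY.1, one_mul]
  rw [ha, hb, two_inner_eq_sum hX hY, two_inner_eq_sum hX' hY']
  simp only [← Finset.sum_add_distrib, ← mul_add]
  exact Finset.sum_nonneg fun i _ => Finset.sum_nonneg fun j _ =>
    mul_nonneg (sq_nonneg _) (h i j)

lemma spectral_sum_nonneg_single (hX : Diagonalizes U x X) (hY : Diagonalizes V y Y)
    (a b : Fin n₁ ⊕ Fin n₂ → ℝ) (k : ℝ) (h : ∀ i j, 0 ≤ a i + b j + k * (x i * y j)) :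
    0 ≤ ∑ i, a i + ∑ j, b j + k * (2 * inner ℝ X Y) := by
  have := spectral_sum_nonneg (hX.combine hX k 0) (hX.combine hX 0 0) hY hY a b
    (fun i j => by linarith [h i j])
  simp only [zero_smul, add_zero, inner_zero_left, mul_zero, real_inner_smul_left] at this
  linarith

/-- Odd functional calculus on singular values. -/
lemma Diagonalizes.exists_map (hX : Diagonalizes U x X) {ζ : ℝ → ℝ} (hζ : ∀ t, ζ (-t) = -ζ t) :
    ∃ Y, Diagonalizes U (fun i => ζ (x i)) Y := by
  set D := diagonal (fun i => (x i : 𝕜)) with hD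
  set E := diagonal (fun i => (ζ (x i) : 𝕜)) with hE
  -- A Hermitian matrix is a dilation exactly when it anticommutes with `J`. In the eigenbasis, `J`
  -- links only eigenvalues with `x j = -x i`, so an odd `ζ` preserves anticommutation.
  set J : Matrix (Fin n₁ ⊕ Fin n₂) (Fin n₁ ⊕ Fin n₂) 𝕜 := fromBlocks 1 0 0 (-1) with hJ
  have hU' : U * Uᴴ = 1 := mul_eq_one_comm.1 hX.1
  have hJX : J * dilation X = -(dilation X * J) := by
    simp [hJ, dilation, fromBlocks_multiply, fromBlocks_neg]
  set T := Uᴴ * J * U with hT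
  have hTD : T * D = -(D * T) := by
    have e1 : T * D = Uᴴ * (J * dilation X) * U := by
      rw [hX.2, ← hD]
      simp only [hT, Matrix.mul_assoc, hX.1, Matrix.mul_one]
    have e2 : D * T = Uᴴ * (dilation X * J) * U := by
      rw [hX.2, ← hD]
      simp only [hT, ← Matrix.mul_assoc, hX.1, Matrix.one_mul]
    rw [e1, e2, hJX]
    simp
  have hTE : T * E = -(E * T) := by
    ext i j
    have h := congrFun (congrFun hTD i) j
    rw [hD, Matrix.neg_apply, mul_diagonal, diagonal_mul] at h
    rw [hE, Matrix.neg_apply, mul_diagonal, diagonal_mul]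
    by_cases h0 : T i j = 0
    · simp [h0]
    · have : (x j : 𝕜) = ((-x i : ℝ) : 𝕜) := by
        apply mul_left_cancel₀ h0
        rw [h]
        push_cast
        ring
      rw [RCLike.ofReal_inj.1 this, hζ]
      push_cast
      ring
  set M := U * E * Uᴴ with hM
  have hJM : J * M = -(M * J) := by
    have e1 : J * M = U * (T * E) * Uᴴ := by
      simp only [hT, hM, ← Matrix.mul_assoc, hU', Matrix.one_mul]
    have e2 : M * J = U * (E * T) * Uᴴ := by
      simp only [hT, hM, Matrix.mul_assoc, hU', Matrix.mul_one]
    rw [e1, e2, hTE]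
    simp
  have hMH : Mᴴ = M := by
    have : Eᴴ = E := by
      rw [hE, diagonal_conjTranspose]
      congr 1
      ext i
      simp
    simp only [hM, conjTranspose_mul, conjTranspose_conjTranspose, this, Matrix.mul_assoc]
  refine ⟨M.toBlocks₁₂, hX.1, ?_⟩
  rw [← hE, ← hM, dilation]
  have hb := fromBlocks_toBlocks M
  rw [← hb] at hJM hMH
  rw [hJ, fromBlocks_multiply, fromBlocks_multiply, fromBlocks_neg, fromBlocks_inj] at hJM
  rw [fromBlocks_conjTranspose, fromBlocks_inj] at hMH
  obtain ⟨h11, -, -, h22⟩ := hJM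
  simp only [Matrix.one_mul, Matrix.mul_one, Matrix.zero_mul, Matrix.mul_zero, add_zero, zero_add,
    Matrix.neg_mul, Matrix.mul_neg, neg_neg] at h11 h22
  have z11 : M.toBlocks₁₁ = 0 := by
    ext i j
    exact self_eq_neg.1 (congrFun (congrFun h11 i) j)
  have z22 : M.toBlocks₂₂ = 0 := by
    ext i j
    exact neg_eq_self.1 (congrFun (congrFun h22 i) j)
  conv_rhs => rw [← hb, z11, z22]
  rw [hMH.2.2.1]

lemma finrank_range_prodMap {K E F E' F' : Type*} [Field K] [AddCommGroup E] [AddCommGroup F]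
    [AddCommGroup E'] [AddCommGroup F'] [Module K E] [Module K F] [Module K E'] [Module K F']
    [FiniteDimensional K E'] [FiniteDimensional K F'] (f : E →ₗ[K] E') (g : F →ₗ[K] F') :
    Module.finrank K (LinearMap.range (f.prodMap g)) =
      Module.finrank K (LinearMap.range f) + Module.finrank K (LinearMap.range g) := by
  have h : LinearMap.range (f.prodMap g) = LinearMap.range
      ((LinearMap.range f).subtype.prodMap (LinearMap.range g).subtype) := by
    ext ⟨a, b⟩
    simp [LinearMap.mem_range]
  rw [h, LinearMap.finrank_range_of_inj, Module.finrank_prod]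
  exact Function.Injective.prodMap Subtype.val_injective Subtype.val_injective

-- Up to exchanging the two coordinate blocks, the dilation is the direct sum of `X` and `Xᴴ`.
open scoped ComplexOrder in
lemma rank_dilation (X : Matrix (Fin n₁) (Fin n₂) 𝕜) : (dilation X).rank = 2 * X.rank := by
  let e := LinearEquiv.sumArrowLequivProdArrow (Fin n₁) (Fin n₂) 𝕜 𝕜
  let sw := LinearEquiv.prodComm 𝕜 (Fin n₁ → 𝕜) (Fin n₂ → 𝕜)
  have h : (dilation X).mulVecLin = (e.symm : _ →ₗ[𝕜] _) ∘ₗ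
      ((X.mulVecLin.prodMap Xᴴ.mulVecLin) ∘ₗ ((e.trans sw : _ ≃ₗ[𝕜] _) : _ →ₗ[𝕜] _)) := by
    refine LinearMap.ext fun v => ?_
    funext i
    rcases i with i | i <;>
    simp [dilation, fromBlocks_mulVec, e, sw, LinearEquiv.sumArrowLequivProdArrow,
      Equiv.sumArrowEquivProdArrow, Function.comp_def]
  rw [Matrix.rank, h, LinearMap.range_comp, LinearEquiv.finrank_map_eq,
    LinearMap.range_comp_of_range_eq_top _ (LinearEquiv.range _), finrank_range_prodMap]
  have := rank_conjTranspose X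
  unfold Matrix.rank at this ⊢
  omega

lemma two_rank_eq_sum (hX : Diagonalizes U x X) :
    2 * (X.rank : ℝ) = ∑ i, if x i = 0 then (0 : ℝ) else 1 := by
  have hdet : IsUnit U.det := by
    apply (isUnit_iff_isUnit_det U).1
    exact IsUnit.of_mul_eq_one_right _ hX.1
  have hdet' : IsUnit (Uᴴ).det := by
    apply (isUnit_iff_isUnit_det Uᴴ).1
    exact IsUnit.of_mul_eq_one _ hX.1
  have h := rank_dilation X
  classical
  rw [hX.2, rank_mul_eq_left_of_isUnit_det _ _ hdet', rank_mul_eq_right_of_isUnit_det _ _ hdet,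
    rank_diagonal, Fintype.card_subtype] at h
  have h' : ((2 * X.rank : ℕ) : ℝ) = 2 * (X.rank : ℝ) := by push_cast; ring
  rw [← h', ← h, Finset.card_filter]
  push_cast
  refine Finset.sum_congr rfl fun i _ => ?_
  by_cases hi : x i = 0 <;> simp [hi]

end Dilation

/-! ### Scalar inequalities for hard thresholding. -/

section Scalar

/-- The scalar conjugate of `x ↦ x² + s² 1_{x ≠ 0}`. -/
noncomputable def scalarConj (s z : ℝ) : ℝ := max (z ^ 2 - s ^ 2) 0

/-- `x` is half a subgradient of `scalarConj s` at `z`. -/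
def ScalarSubgrad (s x z : ℝ) : Prop :=
  (z = s ∧ 0 ≤ x ∧ x ≤ s) ∨ (z = -s ∧ -s ≤ x ∧ x ≤ 0) ∨ (x = 0 ∧ |z| ≤ s) ∨ (x = z ∧ s ≤ |z|)

/-- The pair `(x, z)` belongs to the graph of the hard thresholding operator, at relative distance
`c` from the threshold `s`. -/
def Thresholded (s c x z : ℝ) : Prop :=
  (x = 0 ∧ |z| ≤ c * s) ∨ (x = z ∧ s ≤ c * |z|)

/-- A maximizer of `w ↦ 2 w z - w² - s² 1_{w ≠ 0}` for `s ≥ 0`. -/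
noncomputable def hardThreshold (s z : ℝ) : ℝ := if |z| ≤ s then 0 else z

/-- The resolvent of half the subdifferential of the conjugate of `scalarConj s`. -/
noncomputable def resolvent (s p : ℝ) : ℝ :=
  if |p| ≤ s then p else if 2 * s ≤ |p| then p / 2 else if 0 < p then s else -s

/-- An odd selection of points `z` with `ScalarSubgrad s x z`. -/
noncomputable def liftThreshold (s x : ℝ) : ℝ :=
  if s ≤ |x| then x else if 0 < x then s else if x < 0 then -s else 0

variable {s : ℝ}

lemma ScalarSubgrad.le (hs : 0 ≤ s) {x z : ℝ} (h : ScalarSubgrad s x z) (y : ℝ) :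
    scalarConj s z + 2 * x * (y - z) ≤ scalarConj s y := by
  unfold scalarConj
  rcases h with ⟨rfl, h0, h1⟩ | ⟨rfl, h0, h1⟩ | ⟨rfl, h⟩ | ⟨rfl, h⟩
  · rw [sub_self, max_self]
    rcases le_total y z with hy | hy
    · exact le_trans (by nlinarith) (le_max_right _ _)
    · exact le_trans (by nlinarith) (le_max_left _ _)
  · rw [neg_sq, sub_self, max_self]
    rcases le_total y (-s) with hy | hy
    · exact le_trans (by nlinarith) (le_max_left _ _)
    · exact le_trans (by nlinarith) (le_max_right _ _)
  · have : z ^ 2 - s ^ 2 ≤ 0 := by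
      nlinarith [sq_abs z, abs_nonneg z]
    rw [max_eq_right this]
    simp
  · rcases le_total 0 (x ^ 2 - s ^ 2) with hx | hx
    · rw [max_eq_left hx]
      exact le_trans (by nlinarith [sq_nonneg (x - y)]) (le_max_left _ _)
    · rw [max_eq_right hx]
      have : x ^ 2 = s ^ 2 := by nlinarith [sq_abs x]
      exact le_trans (by nlinarith [sq_nonneg (x - y)]) (le_max_left _ _)

lemma hardThreshold_neg (z : ℝ) : hardThreshold s (-z) = -hardThreshold s z := by
  unfold hardThreshold
  rw [abs_neg]
  split_ifs <;> simp

lemma resolvent_neg (hs : 0 ≤ s) (p : ℝ) : resolvent s (-p) = -resolvent s p := by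
  unfold resolvent
  rw [abs_neg]
  split_ifs with h1 h2 h3 h4 h5
  · rfl
  · ring
  · linarith
  · simp
  · rfl
  · have : p = 0 := by linarith
    simp [this, hs] at h1

lemma liftThreshold_neg (x : ℝ) : liftThreshold s (-x) = -liftThreshold s x := by
  unfold liftThreshold
  rw [abs_neg]
  simp only [neg_pos, Left.neg_neg_iff]
  split_ifs <;> linarith

/-- Minty parametrization of the graph by `p = x + z`: for `p` growing from `0`, first `x = 0` up to
`z = s`, then `z = s` while `x` runs from `0` to `s`, then the diagonal `x = z = p / 2`. -/
lemma scalarSubgrad_resolvent (p : ℝ) :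
    ScalarSubgrad s (p - resolvent s p) (resolvent s p) := by
  unfold resolvent ScalarSubgrad
  split_ifs with h1 h2 h3
  · simp [h1]
  · right; right; right
    refine ⟨by ring, ?_⟩
    rw [abs_div, abs_two]
    linarith
  · left
    rw [abs_of_pos h3] at h1 h2
    refine ⟨rfl, ?_, ?_⟩ <;> linarith
  · right; left
    rw [abs_of_nonpos (by linarith)] at h1 h2
    refine ⟨rfl, ?_, ?_⟩ <;> linarith

lemma scalarConj_eq_hardThreshold (hs : 0 ≤ s) (z : ℝ) :
    scalarConj s z = 2 * hardThreshold s z * z - hardThreshold s z ^ 2 -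
      s ^ 2 * (if hardThreshold s z = 0 then 0 else 1) := by
  unfold scalarConj hardThreshold
  by_cases h : |z| ≤ s
  · rw [max_eq_right (by nlinarith [sq_abs z, abs_nonneg z])]
    simp [h]
  · push Not at h
    have hz : z ≠ 0 := by
      rintro rfl
      simp at h
      linarith
    rw [max_eq_left (by nlinarith [sq_abs z, abs_nonneg z])]
    simp only [not_le.2 h, if_false, hz]
    ring

lemma le_scalarConj (w y : ℝ) :
    2 * w * y - w ^ 2 - s ^ 2 * (if w = 0 then 0 else 1) ≤ scalarConj s y := by
  unfold scalarConj
  split_ifs with h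
  · simp [h]
  · exact le_trans (by nlinarith [sq_nonneg (w - y)]) (le_max_left _ _)

variable {c : ℝ}

/-- Chords of the graph have small slope only because of its flat pieces `z = ±s`. The extreme
chords, from `(0, c s)` to `(s, s)` and from `(s / c, s / c)` to `(0, s)`, both have slope `1 - c`,
which explains the two ends of the window. -/
lemma Thresholded.monotone (hs : 0 ≤ s) (h0 : 0 < c) (h1 : c ≤ 1) {x z x' z' : ℝ}
    (h' : Thresholded s c x' z') (h : ScalarSubgrad s x z) :
    (1 - c) * (x - x') ^ 2 ≤ (z - z') * (x - x') := by
  rcases h' with ⟨rfl, h'⟩ | ⟨rfl, h'⟩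
  · have hl := (abs_le.1 h').1
    have hr := (abs_le.1 h').2
    rcases h with ⟨rfl, h2, h3⟩ | ⟨rfl, h2, h3⟩ | ⟨rfl, h⟩ | ⟨rfl, h⟩
    · nlinarith [mul_nonneg h2 (sub_nonneg.2 h1), mul_nonneg h2 (sub_nonneg.2 hr),
        mul_nonneg (mul_nonneg h2 (sub_nonneg.2 h1)) (sub_nonneg.2 h3)]
    · have hx : 0 ≤ -x := by linarith
      nlinarith [mul_nonneg hx (sub_nonneg.2 hl),
        mul_nonneg (mul_nonneg hx (sub_nonneg.2 h1)) (by linarith : 0 ≤ x + s)]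
    · simp
    · have : z' * x ≤ c * x ^ 2 := by
        calc z' * x ≤ |z' * x| := le_abs_self _
          _ = |z'| * |x| := abs_mul _ _
          _ ≤ c * |x| * |x| := by gcongr; exact h'.trans (by gcongr)
          _ = c * x ^ 2 := by rw [mul_assoc, abs_mul_abs_self]; ring
      nlinarith
  · rcases le_total 0 x' with hx | hx
    · rw [abs_of_nonneg hx] at h'
      rcases h with ⟨rfl, h2, h3⟩ | ⟨rfl, h2, h3⟩ | ⟨rfl, h⟩ | ⟨rfl, h⟩
      · have : 0 ≤ x' - x := by nlinarith
        nlinarith [mul_nonneg this (by nlinarith : 0 ≤ c * x' - z + (1 - c) * x)]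
      · have : 0 ≤ x' - x := by nlinarith
        nlinarith [mul_nonneg this (by nlinarith : 0 ≤ c * x' + s + (1 - c) * x)]
      · have := (abs_le.1 h).2
        nlinarith [mul_nonneg hx (by linarith : 0 ≤ c * x' - z)]
      · nlinarith [mul_nonneg h0.le (sq_nonneg (x - x'))]
    · rw [abs_of_nonpos hx] at h'
      rcases h with ⟨rfl, h2, h3⟩ | ⟨rfl, h2, h3⟩ | ⟨rfl, h⟩ | ⟨rfl, h⟩
      · have : 0 ≤ x - x' := by nlinarith
        nlinarith [mul_nonneg this (by nlinarith : 0 ≤ z - c * x' - (1 - c) * x)]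
      · have : 0 ≤ x - x' := by nlinarith
        nlinarith [mul_nonneg this (by nlinarith : 0 ≤ -s - c * x' - (1 - c) * x)]
      · have := (abs_le.1 h).1
        nlinarith [mul_nonneg (neg_nonneg.2 hx) (by linarith : 0 ≤ z - c * x')]
      · nlinarith [mul_nonneg h0.le (sq_nonneg (x - x'))]

/-- The right side is the convex envelope of `x² + s² 1_{x ≠ 0}`: the line `2 s |x|` from the origin
is tangent to `x² + s²` at `|x| = s`. -/
lemma liftThreshold_value (hs : 0 ≤ s) (x : ℝ) :
    2 * x * liftThreshold s x - scalarConj s (liftThreshold s x) =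
      if s ≤ |x| then x ^ 2 + s ^ 2 else 2 * s * |x| := by
  unfold liftThreshold scalarConj
  split_ifs with h1 h2 h3
  · rw [max_eq_left (by nlinarith [sq_abs x])]
    ring
  · rw [abs_of_pos h2]
    simp
    ring
  · rw [abs_of_neg h3]
    simp
    ring
  · have : x = 0 := by linarith
    simp [this, sq_nonneg]

/-- Quadratic growth of the scalar envelope above its supporting line of slope `2 z'`. -/
lemma Thresholded.bregman (hs : 0 ≤ s) (h0 : 0 < c) (h1 : c ≤ 1) {x' z' : ℝ}
    (h' : Thresholded s c x' z') (x : ℝ) :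
    (1 - c) * (x - x') ^ 2 ≤ 2 * x * liftThreshold s x - scalarConj s (liftThreshold s x)
      + scalarConj s z' - 2 * z' * x := by
  rw [liftThreshold_value hs]
  have hx0 := abs_nonneg x
  have hsq := sq_abs x
  have hzx : z' * x ≤ |z'| * |x| := by rw [← abs_mul]; exact le_abs_self _
  have hz0 := abs_nonneg z'
  rcases h' with ⟨rfl, h'⟩ | ⟨rfl, h'⟩
  · have : 0 ≤ scalarConj s z' := le_max_right _ _
    have hzx' : |z'| * |x| ≤ c * s * |x| := by gcongr
    split_ifs with h
    · nlinarith [sq_nonneg (|x| - s), mul_nonneg h0.le (sq_nonneg (|x| - s)), mul_nonneg hs hs]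
    · push Not at h
      nlinarith [mul_nonneg (mul_nonneg hx0 (sub_nonneg.2 h1)) (by linarith : 0 ≤ s - |x|),
        mul_nonneg (mul_nonneg hx0 (sub_nonneg.2 h1)) hs]
  · have hz : s ≤ |x'| := h'.trans (by nlinarith)
    have : scalarConj s x' = x' ^ 2 - s ^ 2 := max_eq_left (by nlinarith [sq_abs x'])
    rw [this]
    split_ifs with h
    · nlinarith [mul_nonneg h0.le (sq_nonneg (x - x'))]
    · push Not at h
      have hcx : c * (x' * x) ≤ c * |x'| * |x| := by
        rw [mul_assoc]; gcongr
      have hsq' := sq_abs x'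
      have hca : c * |x| ≤ s := by nlinarith
      have hmono : (s - c * |x|) ^ 2 ≤ (c * |x'| - c * |x|) ^ 2 :=
        pow_le_pow_left₀ (by linarith) (by linarith) 2
      -- The product equals `(c|x'| - c|x|)² - c (s - |x|)²`; after `hmono` there remains `(1 -
      -- c)(s² - c|x|²)`.
      have hF : 0 ≤ c * (2 * s * |x| - s ^ 2 - (1 - c) * |x| ^ 2 + c * |x'| ^ 2
          - 2 * (c * |x'| * |x|)) := by
        nlinarith [mul_nonneg (sub_nonneg.2 h1) (by nlinarith : 0 ≤ s ^ 2 - c * |x| ^ 2)]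
      have := nonneg_of_mul_nonneg_right hF h0
      nlinarith

end Scalar
-- From scalar inequalities to the rank penalty.
section Spectral

open Matrix

variable {𝕜 : Type*} [RCLike 𝕜] {n₁ n₂ : ℕ}

/-- The functional `μ rank`. -/
noncomputable def rankPenalty (μ : ℝ) (Y : Matrix (Fin n₁) (Fin n₂) 𝕜) : ℝ := μ * (Y.rank : ℝ)

variable {μ : ℝ} {U V : Matrix (Fin n₁ ⊕ Fin n₂) (Fin n₁ ⊕ Fin n₂) 𝕜}
  {x z y : Fin n₁ ⊕ Fin n₂ → ℝ} {X Y Z : Matrix (Fin n₁) (Fin n₂) 𝕜}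

lemma rankPenalty_nonneg (hμ : 0 ≤ μ) (Y : Matrix (Fin n₁) (Fin n₂) 𝕜) :
    0 ≤ rankPenalty μ Y :=
  mul_nonneg hμ (Nat.cast_nonneg _)

lemma conjFun_rankPenalty_le (hμ : 0 ≤ μ) (hY : Diagonalizes U y Y) :
    2 * conjFun (rankPenalty μ) Y ≤ ∑ i, scalarConj √μ (y i) := by
  have hb : conjFun (rankPenalty μ) Y ≤ (∑ i, scalarConj √μ (y i)) / 2 := by
    refine conjFun_le fun W => ?_
    obtain ⟨V, w, hW⟩ := exists_diagonalizes W
    have h := spectral_sum_nonneg_single hW hY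
      (fun i => w i ^ 2 + √μ ^ 2 * (if w i = 0 then 0 else 1))
      (fun j => scalarConj √μ (y j)) (-2)
      (fun i j => by linarith [le_scalarConj (s := √μ) (w i) (y j)])
    rw [Finset.sum_add_distrib, ← Finset.mul_sum, ← two_rank_eq_sum hW, ← two_norm_sq_eq_sum hW,
      Real.sq_sqrt hμ] at h
    unfold rankPenalty
    linarith
  linarith

/-- Hard thresholding the spectrum of `Y` gives a `W` that attains the upper bound. -/
lemma le_conjFun_rankPenalty (hμ : 0 ≤ μ) (hY : Diagonalizes U y Y) :
    ∑ i, scalarConj √μ (y i) ≤ 2 * conjFun (rankPenalty μ) Y := by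
  obtain ⟨W, hW⟩ := hY.exists_map (hardThreshold_neg (s := √μ))
  have h := le_conjFun (rankPenalty_nonneg hμ) W Y
  have e : ∑ i, scalarConj √μ (y i) = 2 * (2 * inner ℝ W Y) - 2 * ‖W‖ ^ 2 - μ * (2 * W.rank) := by
    rw [two_inner_eq_sum_of_same hW hY, two_norm_sq_eq_sum hW, two_rank_eq_sum hW,
      Finset.mul_sum, Finset.mul_sum, ← Finset.sum_sub_distrib, ← Finset.sum_sub_distrib]
    refine Finset.sum_congr rfl fun i _ => ?_
    rw [scalarConj_eq_hardThreshold (Real.sqrt_nonneg μ), Real.sq_sqrt hμ]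
    ring
  unfold rankPenalty at h
  unfold rankPenalty
  linarith

/-- A subgradient pair is simultaneously diagonalizable, and its spectra form scalar subgradient
pairs. -/
lemma IsSubgrad.exists_diagonalizes (hμ : 0 ≤ μ) (h : IsSubgrad (rankPenalty μ) X Z) :
    ∃ U x z, Diagonalizes U x X ∧ Diagonalizes U z Z ∧ ∀ i, ScalarSubgrad √μ (x i) (z i) := by
  -- Functional calculus on `X + Z` produces a subgradient pair with the same sum; uniqueness of the
  -- Minty decomposition identifies it with `(X, Z)`.
  obtain ⟨U, p, hP⟩ := RankReg.exists_diagonalizes (X + Z)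
  obtain ⟨Z₁, hZ₁⟩ := hP.exists_map (resolvent_neg (Real.sqrt_nonneg μ))
  have hX₁ := hP.combine hZ₁ 1 (-1)
  set X₁ := (1 : ℝ) • (X + Z) + (-1 : ℝ) • Z₁ with hX₁def
  have hsub (i) : ScalarSubgrad √μ (1 * p i + -1 * resolvent √μ (p i)) (resolvent √μ (p i)) := by
    have := scalarSubgrad_resolvent (s := √μ) (p i)
    rwa [show 1 * p i + -1 * resolvent √μ (p i) = p i - resolvent √μ (p i) by ring]
  have h₁ : IsSubgrad (rankPenalty μ) X₁ Z₁ := by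
    refine isSubgrad_of_fenchel (rankPenalty_nonneg hμ) ?_
    have : convEnv (rankPenalty μ) X₁ ≤ 2 * inner ℝ X₁ Z₁ - conjFun (rankPenalty μ) Z₁ := by
      refine convEnv_le fun Y => ?_
      obtain ⟨V, y, hY⟩ := RankReg.exists_diagonalizes Y
      have a1 := conjFun_rankPenalty_le hμ hZ₁
      have a2 := le_conjFun_rankPenalty hμ hY
      have a3 := two_inner_eq_sum_of_same hX₁ hZ₁
      have a4 := spectral_sum_nonneg_single hX₁ hY
        (fun i => 2 * ((1 * p i + -1 * resolvent √μ (p i)) * resolvent √μ (p i)) -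
          scalarConj √μ (resolvent √μ (p i)))
        (fun j => scalarConj √μ (y j)) (-2)
        (fun i j => by linarith [(hsub i).le (Real.sqrt_nonneg μ) (y j)])
      rw [Finset.sum_sub_distrib, ← Finset.mul_sum, ← a3] at a4
      linarith
    linarith
  obtain ⟨e1, e2⟩ := h.eq_of_add_eq h₁ (by rw [hX₁def]; module)
  exact ⟨U, _, _, e1 ▸ hX₁, e2 ▸ hZ₁, hsub⟩

variable {c : ℝ}

lemma inner_sub_ge_of_thresholded (hμ : 0 ≤ μ) (h0 : 0 < c) (h1 : c ≤ 1)
    {X' Z' : Matrix (Fin n₁) (Fin n₂) 𝕜} {x' z' : Fin n₁ ⊕ Fin n₂ → ℝ}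
    (hX' : Diagonalizes V x' X') (hZ' : Diagonalizes V z' Z')
    (ht : ∀ j, Thresholded √μ c (x' j) (z' j)) (h : IsSubgrad (rankPenalty μ) X Z) :
    (1 - c) * ‖X - X'‖ ^ 2 ≤ inner ℝ (Z - Z') (X - X') := by
  obtain ⟨U, x, z, hX, hZ, hs⟩ := h.exists_diagonalizes hμ
  -- The mixed terms of `(z - z')(x - x') - (1 - c)(x - x')²` are `(-z + 2(1 - c)x) x'` and `x
  -- (-z')`, hence two matrix pairs.
  have e := spectral_sum_nonneg (hZ.combine hX (-1) (2 * (1 - c))) hX hX'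
    (hZ'.combine hX' (-1) 0)
    (fun i => z i * x i - (1 - c) * x i ^ 2) (fun j => z' j * x' j - (1 - c) * x' j ^ 2)
    (fun i j => by
      linarith [(ht j).monotone (Real.sqrt_nonneg μ) h0 h1 (hs i)])
  simp only [Finset.sum_sub_distrib, ← Finset.mul_sum, ← two_norm_sq_eq_sum hX,
    ← two_norm_sq_eq_sum hX', ← two_inner_eq_sum_of_same hZ hX,
    ← two_inner_eq_sum_of_same hZ' hX', inner_add_left, inner_add_right, real_inner_smul_left,
    real_inner_smul_right] at e
  rw [norm_sub_sq_real]
  simp only [inner_sub_left, inner_sub_right]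
  rw [real_inner_comm X Z']
  linarith

lemma convEnv_ge_of_thresholded (hμ : 0 ≤ μ) (h0 : 0 < c) (h1 : c ≤ 1)
    {X' Z' : Matrix (Fin n₁) (Fin n₂) 𝕜} {x' z' : Fin n₁ ⊕ Fin n₂ → ℝ}
    (hX' : Diagonalizes V x' X') (hZ' : Diagonalizes V z' Z')
    (ht : ∀ j, Thresholded √μ c (x' j) (z' j)) (h : IsSubgrad (rankPenalty μ) X' Z')
    (X : Matrix (Fin n₁) (Fin n₂) 𝕜) :
    convEnv (rankPenalty μ) X' + 2 * inner ℝ Z' (X - X') + (1 - c) * ‖X - X'‖ ^ 2 ≤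
      convEnv (rankPenalty μ) X := by
  obtain ⟨U, x, hX⟩ := exists_diagonalizes X
  -- `Y` serves as a subgradient at `X`, so its affine minorant gives a sharp lower bound for the
  -- envelope there.
  obtain ⟨Y, hY⟩ := hX.exists_map (liftThreshold_neg (s := √μ))
  have a1 := h.fenchel (rankPenalty_nonneg hμ)
  have a2 := le_conjFun_rankPenalty hμ hZ'
  have a3 := conjFun_rankPenalty_le hμ hY
  have a4 := le_convEnv (rankPenalty_nonneg hμ) X Y
  have e := spectral_sum_nonneg_single hX (hZ'.combine hX' (-1) (1 - c))
    (fun i => 2 * (x i * liftThreshold √μ (x i)) - scalarConj √μ (liftThreshold √μ (x i)) -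
      (1 - c) * x i ^ 2)
    (fun j => scalarConj √μ (z' j) - (1 - c) * x' j ^ 2) 2
    (fun i j => by
      linarith [(ht j).bregman (Real.sqrt_nonneg μ) h0 h1 (x i)])
  simp only [Finset.sum_sub_distrib, ← Finset.mul_sum, ← two_norm_sq_eq_sum hX,
    ← two_norm_sq_eq_sum hX', ← two_inner_eq_sum_of_same hX hY, inner_add_right,
    real_inner_smul_right] at e
  rw [norm_sub_sq_real, inner_sub_right, real_inner_comm X Z', real_inner_comm X' Z']
  linarith

/-- The envelope touches `μ rank` at thresholded points. -/
lemma le_convEnv_of_thresholded (hμ : 0 ≤ μ) (h1 : c ≤ 1)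
    (hX : Diagonalizes U x X) (hZ : Diagonalizes U z Z)
    (ht : ∀ j, Thresholded √μ c (x j) (z j)) :
    ‖X‖ ^ 2 + rankPenalty μ X ≤ convEnv (rankPenalty μ) X := by
  have a1 := conjFun_rankPenalty_le hμ hZ
  have a2 := le_convEnv (rankPenalty_nonneg hμ) X Z
  have a3 : 2 * ‖X‖ ^ 2 + μ * (2 * X.rank) ≤
      2 * (2 * inner ℝ X Z) - ∑ i, scalarConj √μ (z i) := by
    rw [two_norm_sq_eq_sum hX, two_rank_eq_sum hX, two_inner_eq_sum_of_same hX hZ, Finset.mul_sum,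
      Finset.mul_sum, ← Finset.sum_add_distrib, ← Finset.sum_sub_distrib]
    refine Finset.sum_le_sum fun i _ => ?_
    have hs := Real.sqrt_nonneg μ
    have hs2 := Real.sq_sqrt hμ
    unfold scalarConj
    rcases ht i with ⟨h, h'⟩ | ⟨h, h'⟩
    · have : |z i| ≤ √μ := by nlinarith
      rw [max_eq_right (by nlinarith [sq_abs (z i), abs_nonneg (z i)])]
      simp [h]
    · have : √μ ≤ |z i| := by nlinarith [abs_nonneg (z i)]
      rw [max_eq_left (by nlinarith [sq_abs (z i)]), h]
      split_ifs <;> nlinarith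
  unfold rankPenalty at *
  linarith

/-- Nonzero eigenvalues of the dilation are singular values up to sign. -/
lemma Diagonalizes.exists_sigma_eq (hZ : Diagonalizes U z Z) {j : Fin n₁ ⊕ Fin n₂}
    (hj : z j ≠ 0) : ∃ i, sigma Z i = |z j| := by
  have hcol : dilation Z * U = U * diagonal (fun i => (z i : 𝕜)) := by
    rw [hZ.2, Matrix.mul_assoc, hZ.1, Matrix.mul_one]
  set u : Fin n₁ → 𝕜 := fun i => U (Sum.inl i) j with hu
  set v : Fin n₂ → 𝕜 := fun i => U (Sum.inr i) j with hv
  -- The two blocks of an eigenvector of the dilation satisfy `Z v = z u` and `Zᴴ u = z v`, so `v`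
  -- is an eigenvector of `Zᴴ Z` for `z²`.
  have h1 : Z *ᵥ v = (z j : 𝕜) • u := by
    ext i
    have := congrFun (congrFun hcol (Sum.inl i)) j
    rw [mul_apply, mul_diagonal, Fintype.sum_sum_type] at this
    simp only [dilation, fromBlocks_apply₁₁, fromBlocks_apply₁₂, Matrix.zero_apply, zero_mul,
      Finset.sum_const_zero, zero_add] at this
    simp only [mulVec, dotProduct, Pi.smul_apply, smul_eq_mul, hv, hu]
    rw [this, mul_comm]
  have h2 : Zᴴ *ᵥ u = (z j : 𝕜) • v := by
    ext i
    have := congrFun (congrFun hcol (Sum.inr i)) j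
    rw [mul_apply, mul_diagonal, Fintype.sum_sum_type] at this
    simp only [dilation, fromBlocks_apply₂₁, fromBlocks_apply₂₂, Matrix.zero_apply, zero_mul,
      Finset.sum_const_zero, add_zero] at this
    simp only [mulVec, dotProduct, Pi.smul_apply, smul_eq_mul, hv, hu]
    rw [this, mul_comm]
  have hzj : (z j : 𝕜) ≠ 0 := RCLike.ofReal_ne_zero.2 hj
  have hv0 : v ≠ 0 := by
    intro h0
    rw [h0, mulVec_zero] at h1
    have hu0 : u = 0 := (smul_eq_zero.1 h1.symm).resolve_left hzj
    have h3 := congrFun (congrFun hZ.1 j) j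
    rw [mul_apply, one_apply_eq, Fintype.sum_sum_type] at h3
    have a (i) : U (Sum.inl i) j = 0 := congrFun hu0 i
    have b (i) : U (Sum.inr i) j = 0 := congrFun h0 i
    simp [a, b] at h3
  set T := Matrix.toEuclideanLin Z with hT
  have hTv : (LinearMap.adjoint T ∘ₗ T) (WithLp.toLp 2 v) =
      ((z j ^ 2 : ℝ) : 𝕜) • WithLp.toLp 2 v := by
    rw [LinearMap.comp_apply, hT, ← Matrix.toEuclideanLin_conjTranspose_eq_adjoint]
    simp only [Matrix.toLpLin_toLp, toLin'_apply, h1, mulVec_smul, h2]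
    rw [smul_smul, ← WithLp.toLp_smul]
    push_cast
    rw [sq]
  have hev : Module.End.HasEigenvalue (LinearMap.adjoint T ∘ₗ T) ((z j ^ 2 : ℝ) : 𝕜) := by
    refine Module.End.hasEigenvalue_of_hasEigenvector (x := WithLp.toLp 2 v)
      ⟨Module.End.mem_eigenspace_iff.2 hTv, ?_⟩
    simpa using hv0
  obtain ⟨i, hi⟩ := T.isSymmetric_adjoint_comp_self.exists_eigenvalues_eq rfl hev
  have hi' := RCLike.ofReal_inj.1 hi
  have hσ : T.singularValues i = |z j| := by
    rw [T.singularValues_fin rfl, hi', Real.sqrt_sq_eq_abs]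
  -- Positivity places `i` below the rank, hence below `min n₁ n₂`.
  have hpos : 0 < T.singularValues i := by rw [hσ]; exact abs_pos.2 hj
  rw [T.singularValues_pos_iff_lt_finrank_range] at hpos
  have hle1 : Module.finrank 𝕜 (LinearMap.range T) ≤ n₁ := by
    simpa using Submodule.finrank_le (LinearMap.range T)
  have hle2 : Module.finrank 𝕜 (LinearMap.range T) ≤ n₂ := by
    simpa using LinearMap.finrank_range_le T
  exact ⟨⟨i, lt_min (hpos.trans_le hle1) (hpos.trans_le hle2)⟩, hσ⟩

end Spectral
-- Restricted isometry, the spectral gap and the conclusion.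
section Main

variable {𝕜 : Type*} [RCLike 𝕜] {n₁ n₂ : ℕ}
  {H : Type*} [NormedAddCommGroup H] [InnerProductSpace ℝ H]

lemma lrip_bddBelow (A : Matrix (Fin n₁) (Fin n₂) 𝕜 →ₗ[ℝ] H) (K : ℕ) :
    BddBelow {r : ℝ | ∃ X : Matrix (Fin n₁) (Fin n₂) 𝕜,
      X ≠ 0 ∧ X.rank ≤ K ∧ r = ‖A X‖ ^ 2 / ‖X‖ ^ 2} := by
  refine ⟨0, ?_⟩
  rintro _ ⟨X, -, -, rfl⟩
  positivity

lemma one_sub_lrip_mul_le (A : Matrix (Fin n₁) (Fin n₂) 𝕜 →ₗ[ℝ] H) {K : ℕ}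
    {D : Matrix (Fin n₁) (Fin n₂) 𝕜} (hD : D.rank ≤ K) :
    (1 - lrip A K) * ‖D‖ ^ 2 ≤ ‖A D‖ ^ 2 := by
  by_cases h0 : D = 0
  · simp [h0]
  have hpos : 0 < ‖D‖ ^ 2 := by have := norm_pos_iff.2 h0; positivity
  rw [← le_div_iff₀ hpos, lrip, sub_sub_cancel]
  exact csInf_le (lrip_bddBelow A K) ⟨D, h0, hD, rfl⟩

/-- Since `sInf ∅ = 0`, an empty set of quotients would give `lrip A K = 1`. -/
lemma exists_ne_zero_of_lrip_lt_one (A : Matrix (Fin n₁) (Fin n₂) 𝕜 →ₗ[ℝ] H) {K : ℕ}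
    (h : lrip A K < 1) : ∃ X : Matrix (Fin n₁) (Fin n₂) 𝕜, X ≠ 0 ∧ X.rank ≤ K := by
  by_contra! hne
  have : {r : ℝ | ∃ X : Matrix (Fin n₁) (Fin n₂) 𝕜,
      X ≠ 0 ∧ X.rank ≤ K ∧ r = ‖A X‖ ^ 2 / ‖X‖ ^ 2} = ∅ := by
    ext r
    simp only [Set.mem_ofPred_eq, Set.mem_empty_iff_false, iff_false, not_exists]
    rintro X ⟨h1, h2, -⟩
    exact absurd h2 (not_le.2 (hne X h1))
  rw [lrip, this, Real.sInf_empty] at h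
  linarith

lemma rank_sub_le (X Y : Matrix (Fin n₁) (Fin n₂) 𝕜) : (X - Y).rank ≤ X.rank + Y.rank := by
  have h : LinearMap.range (X - Y).mulVecLin ≤
      LinearMap.range X.mulVecLin ⊔ LinearMap.range Y.mulVecLin := by
    rintro _ ⟨v, rfl⟩
    rw [Matrix.mulVecLin_apply, Matrix.sub_mulVec]
    exact sub_mem (Submodule.mem_sup_left ⟨v, rfl⟩) (Submodule.mem_sup_right ⟨v, rfl⟩)
  exact (Submodule.finrank_mono h).trans (Submodule.finrank_add_le_finrank_add_finrank _ _)

/-- Spectra avoiding the closed window are thresholded with a margin. -/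
lemma exists_thresholded {ι : Type*} [Finite ι] {s c : ℝ} (hs : 0 ≤ s) (h0 : 0 < c) (h1 : c ≤ 1)
    {x z : ι → ℝ} (hxz : ∀ i, ScalarSubgrad s (x i) (z i))
    (hz : ∀ i, z i = 0 ∨ |z i| ∉ Set.Icc (c * s) (1 / c * s)) :
    ∃ c', 0 < c' ∧ c' < c ∧ ∀ i, Thresholded s c' (x i) (z i) := by
  -- The excluded window is closed and there are finitely many indices, so `c` can be decreased
  -- slightly.
  have key : ∀ᶠ c' in 𝓝[<] c, ∀ i, 0 < c' → Thresholded s c' (x i) (z i) := by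
    refine eventually_all.2 fun i => ?_
    have hx := hxz i
    unfold ScalarSubgrad at hx
    -- Kernel eigenvalues of the dilation need not be singular values, so the window does not
    -- constrain them; `z = 0` forces `x = 0` anyway.
    by_cases hz0 : z i = 0
    · refine Eventually.of_forall fun c' hc' => Or.inl ⟨?_, ?_⟩
      · rw [hz0] at hx
        rcases hx with ⟨h, h2, h3⟩ | ⟨h, h2, h3⟩ | ⟨h, -⟩ | ⟨h, -⟩ <;> linarith
      · rw [hz0, abs_zero]
        positivity
    · have hout := (hz i).resolve_left hz0
      rw [Set.mem_Icc, not_and_or, not_le, not_le] at hout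
      rcases hout with h | h
      · have hlt : |z i| < s := by nlinarith
        have hx0 : x i = 0 := by
          rcases hx with ⟨h', h2, h3⟩ | ⟨h', h2, h3⟩ | ⟨h', -⟩ | ⟨-, h'⟩
          · rw [h', abs_of_nonneg hs] at hlt
            exact absurd hlt (lt_irrefl _)
          · rw [h', abs_neg, abs_of_nonneg hs] at hlt
            exact absurd hlt (lt_irrefl _)
          · exact h'
          · linarith
        have ht : Tendsto (fun c' => c' * s) (𝓝 c) (𝓝 (c * s)) := by
          apply Continuous.tendsto
          fun_prop
        filter_upwards [(ht.mono_left nhdsWithin_le_nhds).eventually_const_lt h] with c' hc' _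
        exact Or.inl ⟨hx0, hc'.le⟩
      · have h' : s < c * |z i| := by
          rw [one_div, inv_mul_lt_iff₀ h0] at h
          exact h
        have hlt : s < |z i| := by nlinarith [abs_nonneg (z i)]
        have hx0 : x i = z i := by
          rcases hx with ⟨h', h2, h3⟩ | ⟨h', h2, h3⟩ | ⟨-, h'⟩ | ⟨h', -⟩
          · rw [h', abs_of_nonneg hs] at hlt
            exact absurd hlt (lt_irrefl _)
          · rw [h', abs_neg, abs_of_nonneg hs] at hlt
            exact absurd hlt (lt_irrefl _)
          · linarith
          · exact h'
        have ht : Tendsto (fun c' => c' * |z i|) (𝓝 c) (𝓝 (c * |z i|)) := by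
          apply Continuous.tendsto
          fun_prop
        filter_upwards [(ht.mono_left nhdsWithin_le_nhds).eventually_const_lt h'] with c' hc' _
        exact Or.inr ⟨hx0, hc'.le⟩
  have hpos : ∀ᶠ c' in 𝓝[<] c, 0 < c' := nhdsWithin_le_nhds (lt_mem_nhds h0)
  obtain ⟨c', hk, hc', hlt⟩ := (key.and (hpos.and self_mem_nhdsWithin)).exists
  exact ⟨c', hc', hlt, fun i => hk i hc'⟩

/-- Strong monotonicity and strong convexity of the envelope at a point whose subgradient has
singular values outside the window. -/
lemma exists_strong_bounds {μ : ℝ} (hμ : 0 ≤ μ) {c : ℝ} (h0 : 0 < c)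
    {X' Z' : Matrix (Fin n₁) (Fin n₂) 𝕜} (h : IsSubgrad (rankPenalty μ) X' Z')
    (hσ : ∀ i, sigma Z' i ∉ Set.Icc (c * √μ) (1 / c * √μ)) :
    ∃ κ, 1 - c < κ ∧
      (∀ X Z, IsSubgrad (rankPenalty μ) X Z → κ * ‖X - X'‖ ^ 2 ≤ inner ℝ (Z - Z') (X - X')) ∧
      (∀ X, convEnv (rankPenalty μ) X' + 2 * inner ℝ Z' (X - X') + κ * ‖X - X'‖ ^ 2 ≤
        convEnv (rankPenalty μ) X) ∧
      (c ≤ 1 → ‖X'‖ ^ 2 + rankPenalty μ X' ≤ convEnv (rankPenalty μ) X') := by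
  by_cases h1 : c ≤ 1
  · obtain ⟨U, x, z, hX, hZ, hxz⟩ := h.exists_diagonalizes hμ
    have hz (i) : z i = 0 ∨ |z i| ∉ Set.Icc (c * √μ) (1 / c * √μ) := by
      by_cases hz : z i = 0
      · exact Or.inl hz
      · obtain ⟨j, hj⟩ := hZ.exists_sigma_eq hz
        exact Or.inr (hj ▸ hσ j)
    obtain ⟨c', hc0, hlt, ht⟩ := exists_thresholded (Real.sqrt_nonneg μ) h0 h1 hxz hz
    have hc1 : c' ≤ 1 := hlt.le.trans h1
    exact ⟨1 - c', by linarith,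
      fun X Z hXZ => inner_sub_ge_of_thresholded hμ hc0 hc1 hX hZ ht hXZ,
      convEnv_ge_of_thresholded hμ hc0 hc1 hX hZ ht h,
      fun _ => le_convEnv_of_thresholded hμ hc1 hX hZ ht⟩
  -- Here `1 - c < 0`, so plain convexity with `κ = 0` already suffices.
  · refine ⟨0, by linarith, fun X Z hXZ => ?_, fun X => ?_, fun h => absurd h h1⟩
    · rw [zero_mul]
      exact hXZ.monotone h
    · rw [zero_mul, add_zero]
      exact h X

lemma regFunctional_eq (μ : ℝ) (A : Matrix (Fin n₁) (Fin n₂) 𝕜 →ₗ[ℝ] H) (b : H)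
    (X : Matrix (Fin n₁) (Fin n₂) 𝕜) :
    regFunctional μ A b X = convEnv (rankPenalty μ) X + (‖A X - b‖ ^ 2 - ‖X‖ ^ 2) := by
  have : regFunctional μ A b X = quadEnvelope 2 (rankPenalty μ) X + ‖A X - b‖ ^ 2 := rfl
  rw [this, convEnv]
  ring

end Main

end RankReg

theorem theorem5p1 {𝕜 : Type*} [RCLike 𝕜] {n₁ n₂ : ℕ}
    {H : Type*} [NormedAddCommGroup H] [InnerProductSpace ℝ H] [FiniteDimensional ℝ H]
    (A : Matrix (Fin n₁) (Fin n₂) 𝕜 →ₗ[ℝ] H) (b : H) (μ : ℝ) (hμ : 0 ≤ μ) (K : ℕ)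
    (hδ : RankReg.lrip A (2 * K) < 1)
    (X' : Matrix (Fin n₁) (Fin n₂) 𝕜)
    (hX' : RankReg.IsStationary (RankReg.regFunctional μ A b) X')
    (hrank : X'.rank ≤ K)
    (hσ : ∀ i, RankReg.sigma (RankReg.zPoint A b X') i ∉
      Set.Icc ((1 - RankReg.lrip A (2 * K)) * √μ) (1 / (1 - RankReg.lrip A (2 * K)) * √μ)) :
    {X : Matrix (Fin n₁) (Fin n₂) 𝕜 |
        X.rank ≤ K ∧ IsMinOn (RankReg.regFunctional μ A b) {Y | Y.rank ≤ K} X} = {X'} ∧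
    (∀ X'' : Matrix (Fin n₁) (Fin n₂) 𝕜,
      RankReg.IsStationary (RankReg.regFunctional μ A b) X'' → X'' ≠ X' → K < X''.rank) ∧
    (RankReg.opNorm A < 1 → ‖A X' - b‖ ^ 2 ≤ μ →
      IsMinOn (RankReg.rankFunctional μ A b) Set.univ X' ∧
      IsMinOn (RankReg.regFunctional μ A b) Set.univ X') := by
  open RankReg in
  have hf := rankPenalty_nonneg (𝕜 := 𝕜) (n₁ := n₁) (n₂ := n₂) hμ
  have hsub := isSubgrad_zPoint hf A b hX'
  obtain ⟨κ, hκ, hmono, hbreg, htouch⟩ := exists_strong_bounds hμ (sub_pos.2 hδ) hsub hσ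
  have hrip (X : Matrix (Fin n₁) (Fin n₂) 𝕜) (hX : X.rank ≤ K) :
      (1 - lrip A (2 * K)) * ‖X - X'‖ ^ 2 ≤ ‖A (X - X')‖ ^ 2 := by
    refine one_sub_lrip_mul_le A ((rank_sub_le X X').trans ?_)
    omega
  have hnorm {X : Matrix (Fin n₁) (Fin n₂) 𝕜} (hX : X ≠ X') : 0 < ‖X - X'‖ ^ 2 := by
    have := norm_pos_iff.2 (sub_ne_zero.2 hX)
    positivity
  have hlt (X : Matrix (Fin n₁) (Fin n₂) 𝕜) (hX : X.rank ≤ K) (hne : X ≠ X') :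
      regFunctional μ A b X' < regFunctional μ A b X := by
    rw [regFunctional_eq, regFunctional_eq, residual_expand A b X' X]
    -- The linear terms cancel; the remaining coefficient of `‖X - X'‖²` is at least `κ - lrip A (2
    -- * K) > 0`.
    nlinarith [hbreg X, hrip X hX, mul_lt_mul_of_pos_right hκ (hnorm hne)]
  have hle (X : Matrix (Fin n₁) (Fin n₂) 𝕜) (hX : X.rank ≤ K) :
      regFunctional μ A b X' ≤ regFunctional μ A b X := by
    by_cases hne : X = X'
    · rw [hne]
    · exact (hlt X hX hne).le
  refine ⟨?_, ?_, ?_⟩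
  · ext X
    simp only [Set.mem_ofPred_eq, Set.mem_singleton_iff]
    constructor
    · rintro ⟨hX, hmin⟩
      by_contra hne
      exact absurd (hmin (show X' ∈ {Y | Y.rank ≤ K} from hrank)) (not_le.2 (hlt X hX hne))
    · rintro rfl
      exact ⟨hrank, fun Y hY => hle Y hY⟩
  · intro X'' hX'' hne
    by_contra! hK
    have h := hmono X'' _ (isSubgrad_zPoint hf A b hX'')
    -- With `D = X'' - X'`, adding both expansions gives `⟪Z'' - Z', D⟫ = ‖D‖² - ‖A D‖²`, which is
    -- at most `lrip A (2 * K) * ‖D‖²` and so contradicts `h`.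
    have e1 := residual_expand A b X' X''
    have e2 := residual_expand A b X'' X'
    rw [← neg_sub X'' X', map_neg, norm_neg, norm_neg, inner_neg_right] at e2
    rw [inner_sub_left] at h
    nlinarith [hrip X'' hK, mul_lt_mul_of_pos_right hκ (hnorm hne)]
  · intro hA hb
    have hcontr (D : Matrix (Fin n₁) (Fin n₂) 𝕜) : ‖A D‖ ≤ ‖D‖ :=
      (norm_le_opNorm_mul A D).trans (mul_le_of_le_one_left (norm_nonneg _) hA.le)
    have hc1 : 1 - lrip A (2 * K) ≤ 1 := by
      obtain ⟨D, hD, hDr⟩ := exists_ne_zero_of_lrip_lt_one A hδ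
      have h1 := one_sub_lrip_mul_le A hDr
      have h2 : ‖A D‖ ^ 2 ≤ ‖D‖ ^ 2 := pow_le_pow_left₀ (norm_nonneg _) (hcontr D) 2
      have h3 : 0 < ‖D‖ ^ 2 := by have := norm_pos_iff.2 hD; positivity
      exact le_of_mul_le_mul_right (by linarith) h3
    have htouch := htouch hc1
    have hmin (X : Matrix (Fin n₁) (Fin n₂) 𝕜) :
        rankFunctional μ A b X' ≤ rankFunctional μ A b X := by
      by_cases hX : X.rank ≤ K
      · have h1 := hle X hX
        have h2 := convEnv_le_self hf X
        rw [regFunctional_eq, regFunctional_eq] at h1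
        unfold rankPenalty at *
        unfold rankFunctional
        linarith
      -- One extra unit of rank costs `μ`, which covers the whole residual at `X'`.
      · have h1 : (X'.rank : ℝ) + 1 ≤ X.rank := by
          exact_mod_cast hrank.trans_lt (not_le.1 hX)
        unfold rankFunctional
        nlinarith [sq_nonneg ‖A X - b‖, mul_le_mul_of_nonneg_left h1 hμ]
    refine ⟨fun X _ => hmin X, fun X _ => ?_⟩
    have h1 := le_quadEnvelope_add_of_contraction hf A b hcontr hmin X
    have h2 := convEnv_le_self hf X'
    have h3 := regFunctional_eq μ A b X'
    have h4 : rankFunctional μ A b X' = rankPenalty μ X' + ‖A X' - b‖ ^ 2 := rfl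
    have h5 : regFunctional μ A b X = quadEnvelope 2 (rankPenalty μ) X + ‖A X - b‖ ^ 2 := rfl
    simp only [Set.mem_ofPred_eq]
    linarith
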